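/- **Conventions.** A *contact algebra* is a pair $(B,C)$ of a Boolean algebra $B=(B,0,1,+,\cdot,{}^*)$ ($0=1$ is allowed) and a binary relation $C$ on $B$ such that for all $a,b,c\in B$: $aCb$ implies $a\ne0$ and $b\neq 0$; $aC(b+c)$ iff $aCb$ or $aCc$; $(a+b)Cc$ iff $aCc$ or $bCc$; $a\neq0$ implies $aCa$; $aCb$ implies $bCa$. It is *complete* if $B$ is complete, and *connected* if $a\ne0,1$ implies $aCa^*$ or $a^*Ca$. A *CA-isomorphism* $(B,C)\to(B_1,C_1)$ is a Boolean isomorphism $\varphi$ with $aCb\iff\varphi(a)C_1\varphi(b)$. A *clan* of $(B,C)$ is a non-empty $\Gamma\subseteq B$ such that $0\notin\Gamma$; $a\in\Gamma$ and $a\le b$ imply $b\in\Gamma$; $a+b\in\Gamma$ implies $a\in\Gamma$ or $b\in\Gamma$; and any $a,b\in\Gamma$ satisfy $aC^{\#}b$, i.e. $aCb$ or $bCa$ or $a\cdot b\neq0$. Every ultrafilter of $B$ is a clan. For a topological space $X$, $RC(X)$ is the Boolean algebra of regular closed sets ($F=\mathrm{cl}(\mathrm{int}\,F)$), with $0=\emptyset$,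 $1=X$, $F+G=F\cup G$, $F\cdot G=\mathrm{cl}(\mathrm{int}(F\cap G))$, $F^*=\mathrm{cl}(X\setminus F)$. For a dense subspace $X_0\subseteq X$, let $CO(X_0)$ be the Boolean algebra of clopen subsets of $X_0$ and $RC(X,X_0)=\{\mathrm{cl}_X(A): A\in CO(X_0)\}$, a Boolean subalgebra of $RC(X)$; it is a contact algebra with the relation $F\,C_{(X,X_0)}\,G\iff F\cap G\ne\emptyset$. A *2-contact space* is a pair $(X,X_0)$ of a topological space $X$ and a dense subspace $X_0$ such that: $X$ is $T_0$; $X_0$ is a Stone space (compact, Hausdorff, with a base of clopen sets); $RC(X,X_0)$ is a closed base of $X$ (its members are closed and every closed set is an intersection of members); and for every clan $\Gamma$ of $(CO(X_0),\delta)$, where $F\,\delta\,G\iff \mathrm{cl}_X(F)\cap\mathrm{cl}_X(G)\neq\emptyset$, there is $x\in X$ with $\Gamma=\{F\in CO(X_0): x\in\mathrm{cl}_X(F)\}$. It is *connected* if $X$ is connected, i.e. $X$ is not a union of two disjoint non-empty open sets (the empty space is connected). A *CS-isomorphism* $(X,X_0)\to(Y,Y_0)$ is a homeomorphism $f:X\to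 Y$ with $f(X_0)=Y_0$. The *canonical contact algebra* of $(X,X_0)$ is $\underline B^c(X,X_0)=(RC(X,X_0),C_{(X,X_0)})$. The *canonical 2-contact space* $\underline X^c(\underline B)=(X,X_0)$ of a contact algebra $\underline B=(B,C)$ consists of the set $X$ of all clans of $(B,C)$, topologized by the closed base $\{g_B(a):a\in B\}$, where $g_B(a)=\{\Gamma\in X: a\in\Gamma\}$, and the subspace $X_0$ of all ultrafilters of $B$; it is a 2-contact space. **Theorem 7.1 (New representation theorem for contact algebras).** (a) Let $(B,C)$ be a contact algebra and let $(X,X_0)$ be its canonical 2-contact space. Then $g_B$ is a CA-isomorphism from $(B,C)$ onto the canonical contact algebra $(RC(X,X_0),C_{(X,X_0)})$ of $(X,X_0)$. The sets $RC(X,X_0)$ and $RC(X)$ coincide iff $(B,C)$ is complete. The contact algebra $(B,C)$ is connected iff the 2-contact space $(X,X_0)$ is connected. (b) There is a bijective correspondence between the class of all contact algebras, up to CA-isomorphism, and the class of all 2-contact spaces, up to CS-isomorphism: for every contact algebra $\underline B$, the class $[\underline B]$ corresponds to $[\underline X^c(\underline B)]$, and for every 2-contact space $(X,X_0)$, the class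 $[(X,X_0)]$ corresponds to $[\underline B^c(X,X_0)]$. This correspondence restricts to a bijection between the classes of connected contact algebras and the classes of connected 2-contact spaces. -/

import Mathlib

open Set TopologicalSpace

universe u

namespace TwoContact

section Algebra

variable {B : Type u} [BooleanAlgebra B]

/-- Precontact relations on a Boolean algebra: axioms (C0) and (C+). -/
structure IsPrecontact (C : B → B → Prop) : Prop where
  ne_bot : ∀ a b, C a b → a ≠ ⊥ ∧ b ≠ ⊥
  sup_right : ∀ a b c, C a (b ⊔ c) ↔ C a b ∨ C a c
  sup_left : ∀ a b c, C (a ⊔ b) c ↔ C a c ∨ C b c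

/-- Contact relations: precontact relations satisfying (Cref) and (Csym). -/
structure IsContact (C : B → B → Prop) : Prop extends IsPrecontact C where
  refl : ∀ a, a ≠ ⊥ → C a a
  symm : ∀ a b, C a b → C b a

/-- The relation `C^#` associated with a relation `C`. -/
def Sharp (C : B → B → Prop) (a b : B) : Prop := C a b ∨ C b a ∨ a ⊓ b ≠ ⊥

/-- Clans with respect to a relation `C`. -/
structure IsClan (C : B → B → Prop) (Γ : Set B) : Prop where
  nonempty : Γ.Nonempty
  bot_notMem : ⊥ ∉ Γ
  mem_of_le : ∀ a b, a ∈ Γ → a ≤ b → b ∈ Γ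
  sup_mem : ∀ a b, a ⊔ b ∈ Γ → a ∈ Γ ∨ b ∈ Γ
  sharp : ∀ a b, a ∈ Γ → b ∈ Γ → Sharp C a b

/-- Ultrafilters of a Boolean algebra. -/
structure IsUltra (U : Set B) : Prop where
  top_mem : ⊤ ∈ U
  bot_notMem : ⊥ ∉ U
  mem_of_le : ∀ a b, a ∈ U → a ≤ b → b ∈ U
  inf_mem : ∀ a b, a ∈ U → b ∈ U → a ⊓ b ∈ U
  mem_or_compl : ∀ a, a ∈ U ∨ aᶜ ∈ U

/-- The set of clans, as a type. -/
@[ext]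
structure Clans (C : B → B → Prop) : Type u where
  carrier : Set B
  isClan : IsClan C carrier

/-- The map `g_B`, sending `a` to the set of all clans that contain `a`. -/
def gMap (C : B → B → Prop) (a : B) : Set (Clans C) := {Γ | a ∈ Γ.carrier}

/-- The topology on the set of clans that has the sets `g_B(a)` as a closed base (equivalently,
their complements as an open base; these are closed under finite intersections). -/
instance clansTopology (C : B → B → Prop) : TopologicalSpace (Clans C) :=
  generateFrom (range fun a => (gMap C a)ᶜ)

/-- The set `Ult(B)` of all ultrafilters, as a subset of the space of clans
(every ultrafilter is a clan). -/
def ultSet (C : B → B → Prop) : Set (Clans C) := {Γ | IsUltra Γ.carrier}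

/-- The Boolean algebra is complete: every subset has a least upper bound. -/
def IsCompleteAlg (B : Type u) [BooleanAlgebra B] : Prop := ∀ S : Set B, ∃ a, IsLUB S a

/-- The connectedness axiom (Ccon). -/
def IsConnectedRel (C : B → B → Prop) : Prop := ∀ a, a ≠ ⊥ → a ≠ ⊤ → C a aᶜ ∨ C aᶜ a

/-- `φ` is a Boolean isomorphism that preserves and reflects the contact relations. -/
structure IsCAIso {B' : Type u} [BooleanAlgebra B'] (C : B → B → Prop) (C' : B' → B' → Prop)
    (φ : B → B') : Prop where
  bijective : Function.Bijective φ
  map_bot : φ ⊥ = ⊥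
  map_top : φ ⊤ = ⊤
  map_sup : ∀ a b, φ (a ⊔ b) = φ a ⊔ φ b
  map_inf : ∀ a b, φ (a ⊓ b) = φ a ⊓ φ b
  map_compl : ∀ a, φ aᶜ = (φ a)ᶜ
  rel_iff : ∀ a b, C a b ↔ C' (φ a) (φ b)

end Algebra

section Topology

variable {X : Type u} [TopologicalSpace X]

/-- Regular closed subsets of a topological space. -/
def IsRegClosed (F : Set X) : Prop := closure (interior F) = F

/-- The set `RC(X)` of regular closed sets, as a type. -/
@[ext]
structure RC (X : Type u) [TopologicalSpace X] : Type u where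
  carrier : Set X
  isRegClosed : IsRegClosed carrier

theorem isRegClosed_closure {U : Set X} (hU : IsOpen U) : IsRegClosed (closure U) := by
  apply subset_antisymm
  · exact closure_minimal interior_subset isClosed_closure
  · exact closure_mono (interior_maximal subset_closure hU)

theorem IsRegClosed.isClosed {F : Set X} (h : IsRegClosed F) : IsClosed F := by
  rw [← h]; exact isClosed_closure

theorem IsRegClosed.union {F G : Set X} (hF : IsRegClosed F) (hG : IsRegClosed G) :
    IsRegClosed (F ∪ G) := by
  apply subset_antisymm
  · exact closure_minimal interior_subset (hF.isClosed.union hG.isClosed)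
  · refine union_subset ?_ ?_
    · conv_lhs => rw [← hF]
      exact closure_mono (interior_mono subset_union_left)
    · conv_lhs => rw [← hG]
      exact closure_mono (interior_mono subset_union_right)

theorem inter_union_aux {F G H : Set X} (hG : IsRegClosed G) (hH : IsRegClosed H) :
    closure (interior (F ∩ (G ∪ H))) ⊆
      closure (interior (F ∩ G)) ∪ closure (interior (F ∩ H)) := by
  rw [← closure_union]
  refine closure_minimal ?_ isClosed_closure
  intro x hx
  rw [mem_closure_iff]
  intro V hV hxV
  have hO : IsOpen (V ∩ interior (F ∩ (G ∪ H))) := hV.inter isOpen_interior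
  have hsub : interior (F ∩ (G ∪ H)) ⊆ F := interior_subset.trans inter_subset_left
  have key : ∀ K : Set X, IsRegClosed K → x ∈ K → (V ∩ interior (F ∩ K)).Nonempty := by
    intro K hK hxK
    rw [← hK] at hxK
    obtain ⟨y, hy, hyK⟩ := mem_closure_iff.1 hxK _ hO ⟨hxV, hx⟩
    exact ⟨y, hy.1, mem_interior.2 ⟨interior (F ∩ (G ∪ H)) ∩ interior K,
      fun z hz => ⟨hsub hz.1, interior_subset hz.2⟩, isOpen_interior.inter isOpen_interior,
      hy.2, hyK⟩⟩
  rcases (interior_subset hx).2 with h | h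
  · obtain ⟨y, h1, h2⟩ := key G hG h
    exact ⟨y, h1, Or.inl h2⟩
  · obtain ⟨y, h1, h2⟩ := key H hH h
    exact ⟨y, h1, Or.inr h2⟩

/-- `RC(X)` is ordered by inclusion. -/
instance rcPartialOrder : PartialOrder (RC X) where
  le F G := F.carrier ⊆ G.carrier
  le_refl F := Subset.refl F.carrier
  le_trans _ _ _ h h' := Subset.trans h h'
  le_antisymm _ _ h h' := RC.ext (Subset.antisymm h h')

/-- The lattice `RC(X)`: `F + G = F ∪ G` and `F . G = cl(int(F ∩ G))`. -/
instance rcLattice : Lattice (RC X) where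
  sup F G := ⟨F.1 ∪ G.1, F.2.union G.2⟩
  inf F G := ⟨closure (interior (F.1 ∩ G.1)), isRegClosed_closure isOpen_interior⟩
  le_sup_left F G := show F.1 ⊆ F.1 ∪ G.1 from subset_union_left
  le_sup_right F G := show G.1 ⊆ F.1 ∪ G.1 from subset_union_right
  sup_le F G H h1 h2 := show F.1 ∪ G.1 ⊆ H.1 from union_subset h1 h2
  inf_le_left F G := show closure (interior (F.1 ∩ G.1)) ⊆ F.1 from
    closure_minimal (interior_subset.trans inter_subset_left) F.2.isClosed
  inf_le_right F G := show closure (interior (F.1 ∩ G.1)) ⊆ G.1 from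
    closure_minimal (interior_subset.trans inter_subset_right) G.2.isClosed
  le_inf F G H h1 h2 := show F.1 ⊆ closure (interior (G.1 ∩ H.1)) by
    conv_lhs => rw [← F.2]
    exact closure_mono (interior_mono (subset_inter h1 h2))

/-- The Boolean algebra `RC(X)`, with `0 = ∅`, `1 = X` and `F^* = cl(X \ F)`. -/
instance rcBooleanAlgebra : BooleanAlgebra (RC X) where
  __ := DistribLattice.ofInfSupLe (α := RC X) fun F G H => inter_union_aux (F := F.1) G.2 H.2
  compl F := ⟨closure F.1ᶜ, isRegClosed_closure F.2.isClosed.isOpen_compl⟩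
  top := ⟨univ, by simp [IsRegClosed]⟩
  bot := ⟨∅, by simp [IsRegClosed]⟩
  le_top F := subset_univ F.1
  bot_le F := empty_subset F.1
  inf_compl_le_bot F := show closure (interior (F.1 ∩ closure F.1ᶜ)) ⊆ ∅ by
    rw [interior_inter, closure_compl, interior_compl, F.2, ← sdiff_eq,
      sdiff_eq_empty.2 interior_subset, closure_empty]
  top_le_sup_compl F := show univ ⊆ F.1 ∪ closure F.1ᶜ by
    rw [← union_compl_self F.1]
    exact union_subset_union_right _ subset_closure

/-- The set `RC(X, X₀)` of the closures in `X` of the clopen subsets of the subspace `X₀`. -/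
def RCPair (X₀ : Set X) : Set (Set X) :=
  {F | ∃ A : Clopens X₀, closure (Subtype.val '' (A : Set X₀)) = F}

/-- A closed base: a family of closed sets such that every closed set is an intersection of
members of the family. -/
def IsClosedBase (𝓑 : Set (Set X)) : Prop :=
  (∀ F ∈ 𝓑, IsClosed F) ∧ ∀ F : Set X, IsClosed F → ∃ 𝓢 ⊆ 𝓑, F = ⋂₀ 𝓢

/-- The relation `δ` on the clopen subsets of `X₀`: the closures in `X` meet. -/
def Delta (X₀ : Set X) (F G : Clopens X₀) : Prop :=
  (closure (Subtype.val '' (F : Set X₀)) ∩ closure (Subtype.val '' (G : Set X₀))).Nonempty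

/-- Stone spaces: compact Hausdorff spaces with a base of clopen sets. -/
structure IsStone (Y : Type u) [TopologicalSpace Y] : Prop where
  compact : CompactSpace Y
  hausdorff : T2Space Y
  base : IsTopologicalBasis {A : Set Y | IsClopen A}

/-- The pair `(X, X₀)` is a 2-contact space. -/
structure IsTwoContact (X₀ : Set X) : Prop where
  dense : Dense X₀
  t0 : T0Space X
  stone : IsStone X₀
  closedBase : IsClosedBase (RCPair X₀)
  clan : ∀ Γ : Set (Clopens X₀), IsClan (Delta X₀) Γ →
    ∃ x : X, Γ = {F : Clopens X₀ | x ∈ closure (Subtype.val '' (F : Set X₀))}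

theorem closure_inter_dense {X₀ U : Set X} (h : Dense X₀) (hU : IsOpen U) :
    closure (U ∩ X₀) = closure U :=
  subset_antisymm (closure_mono inter_subset_left)
    (closure_minimal (h.open_subset_closure_inter hU) isClosed_closure)

/-- The closure of a clopen subset of a dense subspace is the closure of an open set. -/
theorem exists_isOpen_closure {X₀ : Set X} (h : Dense X₀) (A : Clopens X₀) :
    ∃ U : Set X, IsOpen U ∧ Subtype.val '' (A : Set X₀) = U ∩ X₀ ∧
      closure (Subtype.val '' (A : Set X₀)) = closure U := by
  obtain ⟨U, hU, hA⟩ := isOpen_induced_iff.1 A.isOpen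
  have : Subtype.val '' (A : Set X₀) = U ∩ X₀ := by
    rw [← hA, Subtype.image_preimage_coe, inter_comm]
  exact ⟨U, hU, this, by rw [this, closure_inter_dense h hU]⟩

theorem rcPair_isRegClosed {X₀ : Set X} (h : Dense X₀) {F : Set X} (hF : F ∈ RCPair X₀) :
    IsRegClosed F := by
  obtain ⟨A, rfl⟩ := hF
  obtain ⟨U, hU, -, hc⟩ := exists_isOpen_closure h A
  rw [hc]; exact isRegClosed_closure hU

theorem rcPair_compl {X₀ : Set X} (h : Dense X₀) (A : Clopens X₀) :
    closure (Subtype.val '' ((Aᶜ : Clopens X₀) : Set X₀)) =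
      closure (closure (Subtype.val '' (A : Set X₀)))ᶜ := by
  obtain ⟨U, hU, hA, hc⟩ := exists_isOpen_closure h A
  obtain ⟨V, hV, hA', hc'⟩ := exists_isOpen_closure h Aᶜ
  rw [hc, hc']
  have hdisj : Disjoint V U := by
    rw [disjoint_iff_inter_eq_empty]
    by_contra hne
    obtain ⟨x, hx, hx0⟩ := h.inter_open_nonempty _ (hV.inter hU) (nonempty_iff_ne_empty.2 hne)
    have h1 : x ∈ Subtype.val '' ((Aᶜ : Clopens X₀) : Set X₀) := by rw [hA']; exact ⟨hx.1, hx0⟩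
    have h2 : x ∈ Subtype.val '' (A : Set X₀) := by rw [hA]; exact ⟨hx.2, hx0⟩
    obtain ⟨y, hy, rfl⟩ := h1
    obtain ⟨z, hz, hzy⟩ := h2
    rw [Subtype.val_injective hzy] at hz
    exact hy hz
  apply subset_antisymm
  · exact closure_mono (subset_compl_iff_disjoint_right.2 (hdisj.closure_right hV))
  · rw [← closure_inter_dense h isClosed_closure.isOpen_compl]
    apply closure_mono
    rintro x ⟨hx, hx0⟩
    have : x ∈ Subtype.val '' ((Aᶜ : Clopens X₀) : Set X₀) := by
      refine ⟨⟨x, hx0⟩, fun hxA => hx (subset_closure ?_), rfl⟩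
      have : x ∈ Subtype.val '' (A : Set X₀) := ⟨⟨x, hx0⟩, hxA, rfl⟩
      rw [hA] at this; exact this.1
    rw [hA'] at this; exact this.1

theorem rcPair_union {X₀ : Set X} {F G : Set X} (hF : F ∈ RCPair X₀) (hG : G ∈ RCPair X₀) :
    F ∪ G ∈ RCPair X₀ := by
  obtain ⟨A, rfl⟩ := hF
  obtain ⟨A', rfl⟩ := hG
  exact ⟨A ⊔ A', by rw [Clopens.coe_sup, image_union, closure_union]⟩

/-- `RC(X, X₀)` as a Boolean subalgebra of `RC(X)`, for a dense subset `X₀`. -/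
def rcSub (X₀ : Set X) (h : Dense X₀) : BooleanSubalgebra (RC X) where
  carrier := {F | F.1 ∈ RCPair X₀}
  supClosed' _ hF _ hG := rcPair_union hF hG
  infClosed' F hF G hG := by
    have hc : ∀ H : RC X, H.1 ∈ RCPair X₀ → (Hᶜ).1 ∈ RCPair X₀ := by
      rintro ⟨H, hH⟩ ⟨A, rfl⟩
      exact ⟨Aᶜ, rcPair_compl h A⟩
    have := hc (Fᶜ ⊔ Gᶜ) (rcPair_union (hc F hF) (hc G hG))
    rwa [compl_sup, compl_compl, compl_compl] at this
  compl_mem' {F} hF := by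
    obtain ⟨F, hF'⟩ := F
    obtain ⟨A, rfl⟩ := hF
    exact ⟨Aᶜ, rcPair_compl h A⟩
  bot_mem' := ⟨⊥, show closure _ = (∅ : Set X) by simp⟩

/-- The restriction to `RC(X, X₀)` of the contact relation of `RC(X)`: the sets meet. -/
def rcContact (X₀ : Set X) (h : Dense X₀) (F G : rcSub X₀ h) : Prop := (F.1.1 ∩ G.1.1).Nonempty

theorem rcContact_isContact (X₀ : Set X) (h : Dense X₀) : IsContact (rcContact X₀ h) := by
  have hb : ∀ F : rcSub X₀ h, F ≠ ⊥ ↔ F.1.1.Nonempty := by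
    intro F
    rw [nonempty_iff_ne_empty, not_iff_not]
    constructor
    · rintro rfl; rfl
    · intro hF; exact Subtype.ext (RC.ext hF)
  refine ⟨⟨fun F G hFG => ⟨(hb F).2 hFG.left, (hb G).2 hFG.right⟩, fun F G H => ?_,
    fun F G H => ?_⟩, fun F hF => ?_, fun F G hFG => ?_⟩
  · change (F.1.1 ∩ (G.1.1 ∪ H.1.1)).Nonempty ↔ _
    rw [inter_union_distrib_left, union_nonempty]; rfl
  · change ((F.1.1 ∪ G.1.1) ∩ H.1.1).Nonempty ↔ _
    rw [union_inter_distrib_right, union_nonempty]; rfl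
  · change (F.1.1 ∩ F.1.1).Nonempty
    rw [inter_self]; exact (hb F).1 hF
  · change (G.1.1 ∩ F.1.1).Nonempty
    rw [inter_comm]; exact hFG

end Topology

section CanonicalSpace

variable {B : Type u} [BooleanAlgebra B]

theorem IsUltra.isClan {U : Set B} (h : IsUltra U) (C : B → B → Prop) : IsClan C U where
  nonempty := ⟨⊤, h.top_mem⟩
  bot_notMem := h.bot_notMem
  mem_of_le := h.mem_of_le
  sup_mem a b hab := by
    by_contra! hc
    have ha := (h.mem_or_compl a).resolve_left hc.1
    have hb := (h.mem_or_compl b).resolve_left hc.2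
    have := h.inf_mem _ _ hab (h.inf_mem _ _ ha hb)
    rw [← compl_sup, inf_compl_self] at this
    exact h.bot_notMem this
  sharp a b ha hb := Or.inr (Or.inr fun hab => h.bot_notMem (hab ▸ h.inf_mem a b ha hb))

theorem exists_ultra {a : B} (ha : a ≠ ⊥) : ∃ U : Set B, IsUltra U ∧ a ∈ U := by
  have hd : Disjoint (Order.PFilter.principal a : Set B) (Order.Ideal.principal (⊥ : B) : Set B) := by
    rw [Set.disjoint_left]
    intro x hx hx'
    have h1 : a ≤ x := Order.PFilter.mem_principal.1 hx
    have h2 : x ≤ ⊥ := Order.Ideal.mem_principal.1 hx'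
    exact ha (le_bot_iff.1 (h1.trans h2))
  obtain ⟨J, hJ, -, hdis⟩ := DistribLattice.prime_ideal_of_disjoint_filter_ideal hd
  have hp := hJ.toIsProper
  refine ⟨(J : Set B)ᶜ, ⟨hp.top_notMem, fun h => h J.bot_mem, fun x y hx hxy hy => hx (J.lower hxy hy),
    fun x y hx hy hxy => (hJ.mem_or_mem hxy).elim hx hy, fun x => ?_⟩, ?_⟩
  · by_contra! hc
    simp only [mem_compl_iff, not_not, SetLike.mem_coe] at hc
    have := Order.Ideal.sup_mem hc.1 hc.2
    rw [sup_compl_eq_top] at this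
    exact hp.top_notMem this
  · exact Set.disjoint_left.1 hdis (Order.PFilter.mem_principal.2 le_rfl)

variable (C : B → B → Prop)

theorem isTopologicalBasis_clans : IsTopologicalBasis (range fun a => (gMap C a)ᶜ) where
  exists_subset_inter := by
    rintro _ ⟨a, rfl⟩ _ ⟨b, rfl⟩ Γ ⟨ha, hb⟩
    refine ⟨_, ⟨a ⊔ b, rfl⟩, fun h => (Γ.2.sup_mem a b h).elim ha hb, fun Δ hΔ => ⟨fun h => ?_, fun h => ?_⟩⟩
    · exact hΔ (Δ.2.mem_of_le _ _ h le_sup_left)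
    · exact hΔ (Δ.2.mem_of_le _ _ h le_sup_right)
  sUnion_eq := by
    rw [eq_univ_iff_forall]
    exact fun Γ => ⟨_, ⟨⊥, rfl⟩, Γ.2.bot_notMem⟩
  eq_generateFrom := rfl

theorem isClosed_gMap (a : B) : IsClosed (gMap C a) :=
  ⟨(isTopologicalBasis_clans C).isOpen ⟨a, rfl⟩⟩

/-- The trace on the set of ultrafilters of `g_B(a)` is clopen. -/
def stoneMap (a : B) : Clopens (ultSet C) where
  carrier := {U | a ∈ U.1.1}
  isClopen' := by
    refine ⟨(isClosed_gMap C a).preimage continuous_subtype_val, ?_⟩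
    have : {U : ultSet C | a ∈ U.1.1} = Subtype.val ⁻¹' (gMap C aᶜ)ᶜ := by
      ext U
      constructor
      · intro h h'
        have := U.2.inf_mem _ _ h h'
        rw [inf_compl_self] at this
        exact U.2.bot_notMem this
      · intro h
        exact (U.2.mem_or_compl a).resolve_right h
    rw [this]
    exact (isClosed_gMap C aᶜ).isOpen_compl.preimage continuous_subtype_val

theorem mem_stoneMap {a : B} {U : ultSet C} : U ∈ stoneMap C a ↔ a ∈ U.1.1 := Iff.rfl

theorem isTopologicalBasis_ult :
    IsTopologicalBasis (range fun a => (stoneMap C a : Set (ultSet C))) := by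
  refine isTopologicalBasis_of_isOpen_of_nhds ?_ ?_
  · rintro _ ⟨a, rfl⟩
    exact (stoneMap C a).isOpen
  · intro U O hU hO
    obtain ⟨O', hO', rfl⟩ := isOpen_induced_iff.1 hO
    obtain ⟨_, ⟨a, rfl⟩, h1, h2⟩ := (isTopologicalBasis_clans C).exists_subset_of_mem_open hU hO'
    refine ⟨_, ⟨aᶜ, rfl⟩, (U.2.mem_or_compl a).resolve_left h1, fun V hV => h2 fun hVa => ?_⟩
    have := V.2.inf_mem _ _ hVa hV
    rw [inf_compl_self] at this
    exact V.2.bot_notMem this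

theorem isStone_ult : IsStone (ultSet C) where
  compact := by
    refine ⟨isCompact_iff_ultrafilter_le_nhds.2 fun 𝓕 _ => ?_⟩
    have hu : IsUltra {a : B | (stoneMap C a : Set (ultSet C)) ∈ 𝓕} := by
      refine ⟨Filter.mem_of_superset Filter.univ_mem fun U _ => U.2.top_mem, fun h => ?_,
        fun a b ha hab => Filter.mem_of_superset ha fun U hU => U.2.mem_of_le _ _ hU hab,
        fun a b ha hb => Filter.mem_of_superset (Filter.inter_mem ha hb)
          fun U hU => U.2.inf_mem _ _ hU.1 hU.2, fun a => ?_⟩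
      · obtain ⟨U, hU⟩ := 𝓕.nonempty_of_mem h
        exact U.2.bot_notMem hU
      · rcases 𝓕.mem_or_compl_mem (stoneMap C a : Set (ultSet C)) with h | h
        · exact Or.inl h
        · exact Or.inr (Filter.mem_of_superset h fun U hU => (U.2.mem_or_compl a).resolve_left hU)
    refine ⟨⟨⟨_, hu.isClan C⟩, hu⟩, mem_univ _, ?_⟩
    rw [(isTopologicalBasis_ult C).nhds_hasBasis.ge_iff]
    rintro _ ⟨⟨a, rfl⟩, ha⟩
    exact ha
  hausdorff := by
    refine ⟨fun U V hUV => ?_⟩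
    have key : ∀ U V : ultSet C, ∀ a, a ∈ U.1.1 → a ∉ V.1.1 →
        ∃ O O' : Set (ultSet C), IsOpen O ∧ IsOpen O' ∧ U ∈ O ∧ V ∈ O' ∧ Disjoint O O' :=
      fun U V a h h' => ⟨_, _, (stoneMap C a).isOpen, (stoneMap C a).isClosed.isOpen_compl, h, h',
        disjoint_compl_right⟩
    have : ∃ a, ¬ (a ∈ U.1.1 ↔ a ∈ V.1.1) := by
      by_contra! hc
      exact hUV (Subtype.ext (Clans.ext (Set.ext hc)))
    obtain ⟨a, ha⟩ := this
    by_cases h : a ∈ U.1.1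
    · exact key U V a h fun h' => ha ⟨fun _ => h', fun _ => h⟩
    · have h' : a ∈ V.1.1 := by
        by_contra h'
        exact ha ⟨fun x => (h x).elim, fun x => (h' x).elim⟩
      obtain ⟨O, O', h1, h2, h3, h4, h5⟩ := key V U a h' h
      exact ⟨O', O, h2, h1, h4, h3, h5.symm⟩
  base := (isTopologicalBasis_ult C).of_isOpen_of_subset (fun _ h => IsClopen.isOpen h) (by
    rintro _ ⟨a, rfl⟩
    exact (stoneMap C a).isClopen)

theorem stoneMap_surjective (A : Clopens (ultSet C)) : ∃ a, stoneMap C a = A := by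
  have hK : IsCompact (A : Set (ultSet C)) := by
    have := (isStone_ult C).compact
    exact A.isClosed.isCompact
  have hsup : ∀ s : Set B, s.Finite →
      ∃ a, (stoneMap C a : Set (ultSet C)) = ⋃ b ∈ s, (stoneMap C b : Set (ultSet C)) := by
    intro s hs
    induction s, hs using Set.Finite.induction_on with
    | empty => exact ⟨⊥, by rw [biUnion_empty]; exact eq_empty_of_forall_notMem fun U hU => U.2.bot_notMem hU⟩
    | @insert b s _ _ ih =>
      obtain ⟨a, ha⟩ := ih
      refine ⟨b ⊔ a, ?_⟩
      rw [biUnion_insert, ← ha]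
      ext U
      exact ⟨fun h => U.1.2.sup_mem _ _ h, fun h => h.elim
        (fun h => U.2.mem_of_le _ _ h le_sup_left) fun h => U.2.mem_of_le _ _ h le_sup_right⟩
  obtain ⟨t, ht, htf, hcov⟩ := hK.elim_finite_subcover_image
    (b := {a | (stoneMap C a : Set (ultSet C)) ⊆ A}) (c := fun a => (stoneMap C a : Set (ultSet C)))
    (fun a _ => (stoneMap C a).isOpen) (by
      intro U hU
      obtain ⟨_, ⟨a, rfl⟩, h1, h2⟩ :=
        (isTopologicalBasis_ult C).exists_subset_of_mem_open hU A.isOpen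
      exact mem_biUnion (show a ∈ {a | (stoneMap C a : Set (ultSet C)) ⊆ A} from h2) h1)
  obtain ⟨a, ha⟩ := hsup t htf
  refine ⟨a, Clopens.ext ?_⟩
  rw [ha]
  exact subset_antisymm (iUnion₂_subset fun b hb => ht hb) hcov

/-- `g_B(a)` is the closure of its trace on the set of ultrafilters. -/
theorem closure_stoneMap (a : B) :
    closure (Subtype.val '' (stoneMap C a : Set (ultSet C))) = gMap C a := by
  apply subset_antisymm
  · refine closure_minimal ?_ (isClosed_gMap C a)
    rintro _ ⟨U, hU, rfl⟩
    exact hU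
  · intro Γ hΓ
    rw [(isTopologicalBasis_clans C).mem_closure_iff]
    rintro _ ⟨b, rfl⟩ hb
    have hne : a ⊓ bᶜ ≠ ⊥ := fun h => hb (Γ.2.mem_of_le _ _ hΓ
      (by rwa [← disjoint_iff, disjoint_compl_right_iff] at h))
    obtain ⟨U, hU, hab⟩ := exists_ultra hne
    refine ⟨⟨U, hU.isClan C⟩, fun h => ?_, ⟨⟨⟨U, hU.isClan C⟩, hU⟩,
      hU.mem_of_le _ _ hab inf_le_left, rfl⟩⟩
    have := hU.inf_mem _ _ h (hU.mem_of_le _ _ hab inf_le_right)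
    rw [inf_compl_self] at this
    exact hU.bot_notMem this

theorem rcPair_ult : RCPair (ultSet C) = range (gMap C) := by
  ext F
  constructor
  · rintro ⟨A, rfl⟩
    obtain ⟨a, rfl⟩ := stoneMap_surjective C A
    exact ⟨a, (closure_stoneMap C a).symm⟩
  · rintro ⟨a, rfl⟩
    exact ⟨stoneMap C a, closure_stoneMap C a⟩

/-- The canonical 2-contact space is indeed a 2-contact space. -/
theorem isTwoContact_ult : IsTwoContact (ultSet C) where
  dense := by
    have h := closure_stoneMap C ⊤
    intro Γ
    have hΓ : Γ ∈ gMap C ⊤ := by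
      obtain ⟨a, ha⟩ := Γ.2.nonempty
      exact Γ.2.mem_of_le _ _ ha le_top
    rw [← h] at hΓ
    exact closure_mono (by rintro _ ⟨U, -, rfl⟩; exact U.2) hΓ
  t0 := by
    refine ⟨fun Γ Δ h => Clans.ext (Set.ext fun a => ?_)⟩
    exact not_iff_not.1 (h.mem_open_iff (isClosed_gMap C a).isOpen_compl)
  stone := isStone_ult C
  closedBase := by
    rw [rcPair_ult]
    refine ⟨by rintro _ ⟨a, rfl⟩; exact isClosed_gMap C a, fun F hF => ?_⟩
    refine ⟨{G | G ∈ range (gMap C) ∧ F ⊆ G}, fun _ h => h.1, ?_⟩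
    apply subset_antisymm
    · exact subset_sInter fun G hG => hG.2
    · intro Γ hΓ
      by_contra hn
      obtain ⟨_, ⟨a, rfl⟩, h1, h2⟩ :=
        (isTopologicalBasis_clans C).exists_subset_of_mem_open hn hF.isOpen_compl
      exact h1 (hΓ _ ⟨⟨a, rfl⟩, compl_subset_compl.1 h2⟩)
  clan Γ hΓ := by
    have hsup : ∀ a b, stoneMap C (a ⊔ b) = stoneMap C a ⊔ stoneMap C b := fun a b =>
      Clopens.ext <| Set.ext fun U => ⟨fun h => U.1.2.sup_mem _ _ h, fun h => h.elim
        (fun h => U.2.mem_of_le _ _ h le_sup_left) fun h => U.2.mem_of_le _ _ h le_sup_right⟩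
    have hbot : stoneMap C ⊥ = ⊥ :=
      Clopens.ext <| Set.ext fun U => ⟨fun h => U.2.bot_notMem h, fun h => h.elim⟩
    have hdel : ∀ a b, Delta (ultSet C) (stoneMap C a) (stoneMap C b) → Sharp C a b := by
      intro a b h
      rw [Delta, closure_stoneMap, closure_stoneMap] at h
      obtain ⟨Δ, h1, h2⟩ := h
      exact Δ.2.sharp a b h1 h2
    have hc : IsClan C {a | stoneMap C a ∈ Γ} := by
      refine ⟨?_, fun h => hΓ.bot_notMem (hbot ▸ h), fun a b ha hab =>
        hΓ.mem_of_le _ _ ha fun U hU => U.2.mem_of_le _ _ hU hab,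
        fun a b hab => hΓ.sup_mem _ _ (hsup a b ▸ hab), fun a b ha hb => ?_⟩
      · obtain ⟨A, hA⟩ := hΓ.nonempty
        obtain ⟨a, rfl⟩ := stoneMap_surjective C A
        exact ⟨a, hA⟩
      · rcases hΓ.sharp _ _ ha hb with h | h | h
        · exact hdel a b h
        · rcases hdel b a h with h | h | h
          · exact Or.inr (Or.inl h)
          · exact Or.inl h
          · exact Or.inr (Or.inr (by rwa [inf_comm]))
        · refine Or.inr (Or.inr fun hab => h (Clopens.ext (Set.ext fun U =>
            ⟨fun hU => U.2.bot_notMem (hab ▸ U.2.inf_mem _ _ hU.1 hU.2), fun h => h.elim⟩)))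
    refine ⟨⟨_, hc⟩, Set.ext fun A => ?_⟩
    obtain ⟨a, rfl⟩ := stoneMap_surjective C A
    change _ ↔ _ ∈ closure _
    rw [closure_stoneMap]
    rfl

end CanonicalSpace

/-- A contact algebra `(B, C)`. The trivial Boolean algebra, with `0 = 1`, is allowed. -/
structure ContactAlgebra : Type (u + 1) where
  carrier : Type u
  [boolean : BooleanAlgebra carrier]
  rel : carrier → carrier → Prop
  isContact : IsContact rel

attribute [instance] ContactAlgebra.boolean

/-- A 2-contact space `(X, X₀)`. -/
structure TwoContactSpace : Type (u + 1) where
  carrier : Type u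
  [topology : TopologicalSpace carrier]
  sub : Set carrier
  isTwoContact : IsTwoContact sub

attribute [instance] TwoContactSpace.topology

/-- The Boolean algebra `B` is complete. -/
def ContactAlgebra.Complete (A : ContactAlgebra.{u}) : Prop := IsCompleteAlg A.carrier

/-- The contact algebra is connected. -/
def ContactAlgebra.Connected (A : ContactAlgebra.{u}) : Prop := IsConnectedRel A.rel

/-- The 2-contact space `(X, X₀)` is connected: `X` is not the union of two disjoint nonempty
open sets. The empty space counts as connected. -/
def TwoContactSpace.Connected (S : TwoContactSpace.{u}) : Prop := PreconnectedSpace S.carrier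

/-- The canonical 2-contact space of a contact algebra. -/
def ContactAlgebra.space (A : ContactAlgebra.{u}) : TwoContactSpace.{u} where
  carrier := Clans A.rel
  sub := ultSet A.rel
  isTwoContact := isTwoContact_ult A.rel

/-- The canonical contact algebra of a 2-contact space. -/
def TwoContactSpace.algebra (S : TwoContactSpace.{u}) : ContactAlgebra.{u} where
  carrier := rcSub S.sub S.isTwoContact.dense
  rel := rcContact S.sub S.isTwoContact.dense
  isContact := rcContact_isContact S.sub S.isTwoContact.dense

/-- CA-isomorphic contact algebras. -/
instance caSetoid : Setoid ContactAlgebra.{u} where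
  r A A' := ∃ φ : A.carrier → A'.carrier, IsCAIso A.rel A'.rel φ
  iseqv := by
    refine ⟨fun A => ⟨id, Function.bijective_id, rfl, rfl, fun _ _ => rfl, fun _ _ => rfl,
      fun _ => rfl, fun _ _ => Iff.rfl⟩, ?_, ?_⟩
    · rintro A A' ⟨φ, h⟩
      let e := Equiv.ofBijective φ h.bijective
      have he : ∀ b, φ (e.symm b) = b := e.apply_symm_apply
      refine ⟨e.symm, e.symm.bijective, h.bijective.1 ?_, h.bijective.1 ?_,
        fun a b => h.bijective.1 ?_, fun a b => h.bijective.1 ?_, fun a => h.bijective.1 ?_,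
        fun a b => ?_⟩
      · rw [he, h.map_bot]
      · rw [he, h.map_top]
      · rw [h.map_sup, he, he, he]
      · rw [h.map_inf, he, he, he]
      · rw [h.map_compl, he, he]
      · rw [h.rel_iff, he, he]
    · rintro A A' A'' ⟨φ, h⟩ ⟨ψ, k⟩
      refine ⟨ψ ∘ φ, k.bijective.comp h.bijective, ?_, ?_, fun a b => ?_, fun a b => ?_,
        fun a => ?_, fun a b => ?_⟩
      · simp [h.map_bot, k.map_bot]
      · simp [h.map_top, k.map_top]
      · simp [h.map_sup, k.map_sup]
      · simp [h.map_inf, k.map_inf]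
      · simp [h.map_compl, k.map_compl]
      · rw [h.rel_iff, k.rel_iff]; rfl

/-- CS-isomorphic 2-contact spaces. -/
instance csSetoid : Setoid TwoContactSpace.{u} where
  r S S' := ∃ f : S.carrier ≃ₜ S'.carrier, f '' S.sub = S'.sub
  iseqv := by
    refine ⟨fun S => ⟨Homeomorph.refl _, image_id _⟩, ?_, ?_⟩
    · rintro S S' ⟨f, h⟩
      refine ⟨f.symm, ?_⟩
      rw [← h, ← image_comp]
      simp
    · rintro S S' S'' ⟨f, h⟩ ⟨g, k⟩
      refine ⟨f.trans g, ?_⟩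
      rw [← k, ← h, ← image_comp]
      rfl

/-- The class of all contact algebras, up to CA-isomorphism. -/
def CAClass : Type (u + 1) := Quotient caSetoid.{u}

/-- The class of all 2-contact spaces, up to CS-isomorphism. -/
def CSClass : Type (u + 1) := Quotient csSetoid.{u}

/-- The CA-isomorphism class of a contact algebra. -/
def ContactAlgebra.cls (A : ContactAlgebra.{u}) : CAClass.{u} := Quotient.mk caSetoid A

/-- The CS-isomorphism class of a 2-contact space. -/
def TwoContactSpace.cls (S : TwoContactSpace.{u}) : CSClass.{u} := Quotient.mk csSetoid S

end TwoContact

/-!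
The duality rests on two constructions of points from filters and ideals.

*From algebras to spaces.* If `a C b`, the prime ideal theorem, applied once to the ideal
`{x | ¬ x C b}` and once to the ideal `{y | ∃ x ∈ U, ¬ x C y}`, yields ultrafilters `U ∋ a` and
`V ∋ b` with `U × V ⊆ C` (`exists_ultra_pair`). Their union is a clan containing both `a` and `b`,
so that `a C b` holds exactly when `g(a)` meets `g(b)` (`rel_iff_gMap_inter_nonempty`). As `g` is
also an order embedding onto `RC(X, X₀)`, it is an isomorphism of contact algebras
(`isCAIso_gIso`). Completeness of the algebra and connectedness of the space are then read off the
sets `g(a)`: these exhaust the regular closed sets exactly when all suprema exist, and they always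
include the clopen sets (`rcPair_eq_regClosed_iff`, `isConnectedRel_iff_preconnectedSpace`).

*From spaces to algebras.* Let `φ` be an isomorphism of a contact algebra `A` onto the canonical
algebra of a 2-contact space `(X, X₀)`. The map sending a point `x` to the clan `{a | x ∈ φ a}` is a
homeomorphism of `X` onto the space of clans of `A`, and it sends `X₀` onto the set of ultrafilters
(`exists_homeomorph_space`): `T₀` gives injectivity, the clan axiom surjectivity, the closed base
bicontinuity, and compactness of `X₀` the statement about ultrafilters. With `φ` the identity, this
says that every 2-contact space is the canonical space of its canonical algebra. With `φ` the
composite of an isomorphism `A ≅ A'` and `g`, it says that the canonical spaces of isomorphic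
algebras are isomorphic.
-/

namespace TwoContact

/-! ### Isomorphisms of contact algebras -/

section Algebra

variable {B : Type u} [BooleanAlgebra B] {C : B → B → Prop}

theorem isCAIso_of_orderIso {B' : Type u} [BooleanAlgebra B'] {C' : B' → B' → Prop}
    (e : B ≃o B') (h : ∀ a b, C a b ↔ C' (e a) (e b)) : IsCAIso C C' e where
  bijective := e.bijective
  map_bot := map_bot e
  map_top := map_top e
  map_sup := map_sup e
  map_inf := map_inf e
  map_compl := map_compl' e
  rel_iff := h

theorem IsCAIso.le_iff_le {B' : Type u} [BooleanAlgebra B'] {C' : B' → B' → Prop} {φ : B → B'}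
    (h : IsCAIso C C' φ) {a b : B} : φ a ≤ φ b ↔ a ≤ b := by
  rw [← sup_eq_right, ← h.map_sup, h.bijective.1.eq_iff, sup_eq_right]

/-! ### Clans and ultrafilters -/

theorem IsPrecontact.mono (hC : IsPrecontact C) {a b a' b' : B} (h : C a b) (ha : a ≤ a')
    (hb : b ≤ b') : C a' b' := by
  rw [← sup_eq_right.2 ha, hC.sup_left, ← sup_eq_right.2 hb, hC.sup_right]
  exact Or.inl (Or.inl h)

/-- For a contact relation, the relation `C^#` in the definition of clans is `C` itself. -/
theorem IsContact.sharp_iff (hC : IsContact C) {a b : B} : Sharp C a b ↔ C a b := by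
  refine ⟨?_, Or.inl⟩
  rintro (h | h | h)
  · exact h
  · exact hC.symm _ _ h
  · exact hC.toIsPrecontact.mono (hC.refl _ h) inf_le_left inf_le_right

theorem IsClan.top_mem {Γ : Set B} (h : IsClan C Γ) : ⊤ ∈ Γ := by
  obtain ⟨a, ha⟩ := h.nonempty
  exact h.mem_of_le _ _ ha le_top

theorem IsClan.mem_or_compl {Γ : Set B} (h : IsClan C Γ) (a : B) : a ∈ Γ ∨ aᶜ ∈ Γ :=
  h.sup_mem _ _ (by rw [sup_compl_eq_top]; exact h.top_mem)

theorem IsUltra.compl_notMem {U : Set B} (h : IsUltra U) {a : B} (ha : a ∈ U) : aᶜ ∉ U := by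
  intro ha'
  have := h.inf_mem _ _ ha ha'
  rw [inf_compl_self] at this
  exact h.bot_notMem this

/-- A clan is an ultrafilter as soon as it contains no element together with its complement. -/
theorem IsClan.isUltra {Γ : Set B} (h : IsClan C Γ) (hc : ∀ a ∈ Γ, aᶜ ∉ Γ) : IsUltra Γ where
  top_mem := h.top_mem
  bot_notMem := h.bot_notMem
  mem_of_le := h.mem_of_le
  inf_mem a b ha hb := by
    refine (h.mem_or_compl (a ⊓ b)).resolve_right fun hab => ?_
    rw [compl_inf] at hab
    exact (h.sup_mem _ _ hab).elim (hc a ha) (hc b hb)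
  mem_or_compl := h.mem_or_compl

/-- The ultrafilter theorem: an element outside an ideal lies in an ultrafilter that avoids the
ideal. -/
theorem exists_ultra_disjoint {I : Set B} (hbot : ⊥ ∈ I) (hle : ∀ x y, x ≤ y → y ∈ I → x ∈ I)
    (hsup : ∀ x ∈ I, ∀ y ∈ I, x ⊔ y ∈ I) {a : B} (ha : a ∉ I) :
    ∃ U : Set B, IsUltra U ∧ a ∈ U ∧ ∀ x ∈ U, x ∉ I := by
  let K : Order.Ideal B :=
    { carrier := I
      lower' := fun y x hxy hy => hle x y hxy hy
      nonempty' := ⟨⊥, hbot⟩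
      directed' := fun x hx y hy => ⟨x ⊔ y, hsup x hx y hy, le_sup_left, le_sup_right⟩ }
  have hd : Disjoint (Order.PFilter.principal a : Set B) (K : Set B) :=
    Set.disjoint_left.2 fun x hx hx' => ha (hle a x (Order.PFilter.mem_principal.1 hx) hx')
  obtain ⟨J, hJ, hKJ, hdis⟩ := DistribLattice.prime_ideal_of_disjoint_filter_ideal hd
  have hp := hJ.toIsProper
  refine ⟨(J : Set B)ᶜ, ⟨hp.top_notMem, fun h => h J.bot_mem,
    fun x y hx hxy hy => hx (J.lower hxy hy),
    fun x y hx hy hxy => (hJ.mem_or_mem hxy).elim hx hy, fun x => ?_⟩,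
    Set.disjoint_left.1 hdis (Order.PFilter.mem_principal.2 le_rfl), fun x hx hxI => hx (hKJ hxI)⟩
  by_contra! hc
  simp only [mem_compl_iff, not_not, SetLike.mem_coe] at hc
  have := Order.Ideal.sup_mem hc.1 hc.2
  rw [sup_compl_eq_top] at this
  exact hp.top_notMem this

theorem exists_ultra_pair (hC : IsPrecontact C) {a b : B} (hab : C a b) :
    ∃ U V : Set B, IsUltra U ∧ IsUltra V ∧ a ∈ U ∧ b ∈ V ∧ ∀ x ∈ U, ∀ y ∈ V, C x y := by
  obtain ⟨U, hU, haU, hUb⟩ := exists_ultra_disjoint (I := {x | ¬ C x b}) (a := a)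
    (fun h => (hC.ne_bot _ _ h).1 rfl) (fun x y hxy hy hx => hy (hC.mono hx hxy le_rfl))
    (fun x hx y hy hxy => ((hC.sup_left _ _ _).1 hxy).elim hx hy) (not_not.2 hab)
  obtain ⟨V, hV, hbV, hUV⟩ := exists_ultra_disjoint (I := {y | ∃ x ∈ U, ¬ C x y}) (a := b)
    ⟨⊤, hU.top_mem, fun h => (hC.ne_bot _ _ h).2 rfl⟩
    (fun x y hxy ⟨z, hz, hzy⟩ => ⟨z, hz, fun h => hzy (hC.mono h le_rfl hxy)⟩)
    (by
      rintro x ⟨z, hz, hzx⟩ y ⟨w, hw, hwy⟩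
      refine ⟨z ⊓ w, hU.inf_mem _ _ hz hw, fun h => ((hC.sup_right _ _ _).1 h).elim ?_ ?_⟩
      · exact fun h => hzx (hC.mono h inf_le_left le_rfl)
      · exact fun h => hwy (hC.mono h inf_le_right le_rfl))
    (fun ⟨x, hx, hxb⟩ => hUb x hx hxb)
  exact ⟨U, V, hU, hV, haU, hbV, fun x hx y hy => by_contra fun h => hUV y hy ⟨x, hx, h⟩⟩

theorem IsUltra.isClan_union {U V : Set B} (hU : IsUltra U) (hV : IsUltra V)
    (h : ∀ x ∈ U, ∀ y ∈ V, C x y) : IsClan C (U ∪ V) where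
  nonempty := ⟨⊤, Or.inl hU.top_mem⟩
  bot_notMem := fun h => h.elim hU.bot_notMem hV.bot_notMem
  mem_of_le _ _ ha hab := ha.imp (fun ha => hU.mem_of_le _ _ ha hab)
    fun ha => hV.mem_of_le _ _ ha hab
  sup_mem a b hab := hab.elim
    (fun hab => ((hU.isClan C).sup_mem a b hab).imp Or.inl Or.inl)
    fun hab => ((hV.isClan C).sup_mem a b hab).imp Or.inr Or.inr
  sharp a b ha hb := by
    rcases ha with ha | ha <;> rcases hb with hb | hb
    · exact (hU.isClan C).sharp a b ha hb
    · exact Or.inl (h a ha b hb)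
    · exact Or.inr (Or.inl (h b hb a ha))
    · exact (hV.isClan C).sharp a b ha hb

theorem rel_iff_gMap_inter_nonempty (hC : IsContact C) {a b : B} :
    C a b ↔ (gMap C a ∩ gMap C b).Nonempty := by
  constructor
  · intro h
    obtain ⟨U, V, hU, hV, ha, hb, hUV⟩ := exists_ultra_pair hC.toIsPrecontact h
    exact ⟨⟨U ∪ V, hU.isClan_union hV hUV⟩, Or.inl ha, Or.inr hb⟩
  · rintro ⟨Γ, ha, hb⟩
    exact hC.sharp_iff.1 (Γ.2.sharp a b ha hb)

/-! ### The sets of clans that contain a given element -/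

variable (C)

theorem exists_ultra_of_not_le {a b : B} (h : ¬ a ≤ b) :
    ∃ Γ ∈ ultSet C, a ∈ Γ.carrier ∧ b ∉ Γ.carrier := by
  have hne : a ⊓ bᶜ ≠ ⊥ := fun h' => h (by
    rwa [← disjoint_iff, disjoint_compl_right_iff] at h')
  obtain ⟨U, hU, hab⟩ := exists_ultra hne
  exact ⟨⟨U, hU.isClan C⟩, hU, hU.mem_of_le _ _ hab inf_le_left,
    fun hb => hU.compl_notMem hb (hU.mem_of_le _ _ hab inf_le_right)⟩

theorem gMap_subset_gMap {a b : B} : gMap C a ⊆ gMap C b ↔ a ≤ b := by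
  refine ⟨fun h => ?_, fun h Γ ha => Γ.2.mem_of_le _ _ ha h⟩
  by_contra hn
  obtain ⟨Γ, -, ha, hb⟩ := exists_ultra_of_not_le C hn
  exact hb (h ha)

theorem mem_rcPair_gMap (a : B) : gMap C a ∈ RCPair (ultSet C) := by
  rw [rcPair_ult]; exact ⟨a, rfl⟩

theorem isRegClosed_gMap (a : B) : IsRegClosed (gMap C a) :=
  rcPair_isRegClosed (isTwoContact_ult C).dense (mem_rcPair_gMap C a)

/-- The map `g_B`, as an order isomorphism of `B` onto `RC(X, X₀)`. -/
noncomputable def gIso : B ≃o rcSub (ultSet C) (isTwoContact_ult C).dense :=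
  RelIso.ofSurjective
    (OrderEmbedding.ofMapLEIff (fun a => ⟨⟨gMap C a, isRegClosed_gMap C a⟩, mem_rcPair_gMap C a⟩)
      fun _ _ => gMap_subset_gMap C) (by
    rintro ⟨⟨F, hF⟩, hF'⟩
    have h : F ∈ RCPair (ultSet C) := hF'
    rw [rcPair_ult] at h
    obtain ⟨a, rfl⟩ := h
    exact ⟨a, rfl⟩)

variable {C}

theorem isCAIso_gIso (hC : IsContact C) :
    IsCAIso C (rcContact (ultSet C) (isTwoContact_ult C).dense) (gIso C) :=
  isCAIso_of_orderIso _ fun _ _ => rel_iff_gMap_inter_nonempty hC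

/-! ### Completeness and connectedness -/

variable (C)

theorem rcPair_eq_regClosed_iff :
    RCPair (ultSet C) = {F : Set (Clans C) | IsRegClosed F} ↔ IsCompleteAlg B := by
  rw [rcPair_ult]
  constructor
  · intro h S
    -- The supremum of `S` is the element represented by the closure of `⋃ a ∈ S, int g(a)`.
    obtain ⟨c, hc⟩ : closure (⋃ a ∈ S, interior (gMap C a)) ∈ range (gMap C) := by
      rw [h]
      exact isRegClosed_closure (isOpen_biUnion fun _ _ => isOpen_interior)
    refine ⟨c, fun a ha => ?_, fun b hb => ?_⟩
    · rw [← gMap_subset_gMap C, hc, ← isRegClosed_gMap C a]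
      exact closure_mono (subset_biUnion_of_mem (u := fun a => interior (gMap C a)) ha)
    · rw [← gMap_subset_gMap C, hc]
      refine closure_minimal (iUnion₂_subset fun a ha => ?_) (isClosed_gMap C b)
      exact interior_subset.trans ((gMap_subset_gMap C).2 (hb ha))
  · intro h
    apply subset_antisymm
    · rintro _ ⟨a, rfl⟩
      exact isRegClosed_gMap C a
    · intro F hF
      obtain ⟨c, hc⟩ := h {a | Subtype.val '' (stoneMap C a : Set (ultSet C)) ⊆ interior F}
      refine ⟨c, subset_antisymm (fun Γ hΓ => ?_) ?_⟩
      · by_contra hn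
        obtain ⟨_, ⟨b, rfl⟩, h1, h2⟩ := (isTopologicalBasis_clans C).exists_subset_of_mem_open hn
          (IsRegClosed.isClosed hF).isOpen_compl
        -- `b` bounds the set with supremum `c`, because `F ⊆ g(b)`.
        refine h1 (Γ.2.mem_of_le _ _ hΓ (hc.2 fun a ha => ?_))
        rw [← gMap_subset_gMap C, ← closure_stoneMap C a]
        exact closure_minimal (ha.trans (interior_subset.trans (compl_subset_compl.1 h2)))
          (isClosed_gMap C b)
      · have hF' : closure (interior F) = F := hF
        rw [← hF', ← closure_inter_dense (isTwoContact_ult C).dense isOpen_interior]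
        refine closure_minimal ?_ (isClosed_gMap C c)
        rintro Γ ⟨hΓ, hU⟩
        obtain ⟨_, ⟨a, rfl⟩, h1, h2⟩ := (isTopologicalBasis_ult C).exists_subset_of_mem_open
          (show (⟨Γ, hU⟩ : ultSet C) ∈ Subtype.val ⁻¹' interior F from hΓ)
          (isOpen_interior.preimage continuous_subtype_val)
        exact Γ.2.mem_of_le _ _ h1 (hc.1 (image_subset_iff.2 h2))

theorem gMap_union_compl (a : B) : gMap C a ∪ gMap C aᶜ = univ :=
  eq_univ_of_forall fun Γ => Γ.2.mem_or_compl a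

theorem mem_range_gMap_of_isClopen {F : Set (Clans C)} (hF : IsClopen F) : F ∈ range (gMap C) := by
  rw [← rcPair_ult]
  refine ⟨⟨Subtype.val ⁻¹' F, hF.preimage continuous_subtype_val⟩, ?_⟩
  change closure (Subtype.val '' (Subtype.val ⁻¹' F)) = F
  rw [Subtype.image_preimage_coe, inter_comm,
    closure_inter_dense (isTwoContact_ult C).dense hF.isOpen, hF.isClosed.closure_eq]

variable {C}

theorem isConnectedRel_iff_preconnectedSpace (hC : IsContact C) :
    IsConnectedRel C ↔ PreconnectedSpace (Clans C) := by
  rw [preconnectedSpace_iff_clopen]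
  constructor
  · intro h F hF
    obtain ⟨a, rfl⟩ := mem_range_gMap_of_isClopen C hF
    by_contra! hne
    have hbot : a ≠ ⊥ := by
      rintro rfl
      obtain ⟨Γ, hΓ⟩ := hne.1
      exact Γ.2.bot_notMem hΓ
    have htop : a ≠ ⊤ := by
      rintro rfl
      exact hne.2 (eq_univ_of_forall fun Γ => Γ.2.top_mem)
    have haa : C a aᶜ := (h a hbot htop).elim id (hC.symm _ _)
    obtain ⟨Γ, hΓ, hΓ'⟩ := (rel_iff_gMap_inter_nonempty hC).1 haa
    -- The open set `g(a)` meets the closure `g(aᶜ)`, hence contains an ultrafilter with `aᶜ`.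
    rw [← closure_stoneMap] at hΓ'
    obtain ⟨_, h1, U, hU, rfl⟩ := mem_closure_iff.1 hΓ' _ hF.isOpen hΓ
    exact U.2.compl_notMem h1 hU
  · intro h a hbot htop
    by_contra! hn
    have hd : gMap C a ∩ gMap C aᶜ = ∅ :=
      not_nonempty_iff_eq_empty.1 fun h => hn.1 ((rel_iff_gMap_inter_nonempty hC).2 h)
    have hcompl : (gMap C a)ᶜ = gMap C aᶜ :=
      (IsCompl.of_eq hd (gMap_union_compl C a)).compl_eq
    have hcl : IsClopen (gMap C a) :=
      ⟨isClosed_gMap C a, isClosed_compl_iff.1 (hcompl ▸ isClosed_gMap C aᶜ)⟩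
    rcases h _ hcl with h | h
    · obtain ⟨U, hU, ha⟩ := exists_ultra hbot
      exact notMem_empty _ (h ▸ show (⟨U, hU.isClan C⟩ : Clans C) ∈ gMap C a from ha)
    · obtain ⟨Γ, -, -, ha⟩ := exists_ultra_of_not_le C (fun h => htop (top_le_iff.1 h))
      exact ha (eq_univ_iff_forall.1 h Γ)

end Algebra

/-! ### Clopen subsets of the dense subspace and their closures -/

section Topology

variable {X : Type u} [TopologicalSpace X] {X₀ : Set X}

theorem mem_closure_clopens_iff (A : Clopens X₀) (x : X₀) :
    (x : X) ∈ closure (Subtype.val '' (A : Set X₀)) ↔ x ∈ A := by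
  rw [← closure_subtype, A.isClosed.closure_eq]; rfl

/-- Taking closures in `X` is an order isomorphism from the clopen subsets of a dense subspace `X₀`
onto `RC(X, X₀)`; its inverse is the trace on `X₀`. -/
noncomputable def closureIso (h : Dense X₀) : Clopens X₀ ≃o rcSub X₀ h :=
  RelIso.ofSurjective
    (OrderEmbedding.ofMapLEIff (fun A =>
      (⟨⟨closure (Subtype.val '' (A : Set X₀)), rcPair_isRegClosed h ⟨A, rfl⟩⟩, ⟨A, rfl⟩⟩ :
        rcSub X₀ h))
      fun A A' => by
        constructor
        · intro hle x hx
          exact (mem_closure_clopens_iff A' x).1 (hle ((mem_closure_clopens_iff A x).2 hx))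
        · intro hle
          exact closure_mono (image_mono hle)) (by
    rintro ⟨⟨F, hF⟩, A, hA⟩
    exact ⟨A, Subtype.ext (RC.ext hA)⟩)

theorem coe_closureIso (h : Dense X₀) (A : Clopens X₀) :
    (closureIso h A).1.carrier = closure (Subtype.val '' (A : Set X₀)) := rfl

/-- The members of `RC(X, X₀)` that contain a given point form a clan. -/
theorem isClan_mem (h : Dense X₀) (x : X) :
    IsClan (rcContact X₀ h) {F : rcSub X₀ h | x ∈ F.1.carrier} where
  nonempty := ⟨⊤, mem_univ x⟩
  bot_notMem h := h
  mem_of_le _ _ hF hFG := hFG hF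
  sup_mem _ _ hFG := hFG
  sharp _ _ hF hG := Or.inl ⟨x, hF, hG⟩

theorem mem_compl_iff_notMem (h : Dense X₀) (F : rcSub X₀ h) (x : X₀) :
    (x : X) ∈ (Fᶜ).1.carrier ↔ (x : X) ∉ F.1.carrier := by
  obtain ⟨A, rfl⟩ := (closureIso h).surjective F
  rw [← map_compl' (closureIso h), coe_closureIso, coe_closureIso, mem_closure_clopens_iff,
    mem_closure_clopens_iff]
  rfl

/-- The clan axiom of a 2-contact space, in terms of `RC(X, X₀)`: every clan is the clan of a
point. -/
theorem IsTwoContact.exists_point (hX : IsTwoContact X₀) {Γ : Set (rcSub X₀ hX.dense)}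
    (hΓ : IsClan (rcContact X₀ hX.dense) Γ) : ∃ x : X, Γ = {F | x ∈ F.1.carrier} := by
  have hc : IsClan (Delta X₀) (closureIso hX.dense ⁻¹' Γ) := by
    refine ⟨?_, ?_, fun A A' hA hle => ?_, fun A A' hA => ?_, fun A A' hA hA' => ?_⟩
    · obtain ⟨F, hF⟩ := hΓ.nonempty
      obtain ⟨A, rfl⟩ := (closureIso hX.dense).surjective F
      exact ⟨A, hF⟩
    · rw [mem_preimage, map_bot]
      exact hΓ.bot_notMem
    · exact hΓ.mem_of_le _ _ hA ((closureIso hX.dense).monotone hle)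
    · rw [mem_preimage, map_sup] at hA
      exact hΓ.sup_mem _ _ hA
    · exact Or.inl ((rcContact_isContact X₀ hX.dense).sharp_iff.1 (hΓ.sharp _ _ hA hA'))
  obtain ⟨x, hx⟩ := hX.clan _ hc
  refine ⟨x, Set.ext fun F => ?_⟩
  obtain ⟨A, rfl⟩ := (closureIso hX.dense).surjective F
  exact Set.ext_iff.1 hx A

theorem IsTwoContact.eq_of_forall_mem_iff (hX : IsTwoContact X₀) {x y : X}
    (h : ∀ F ∈ RCPair X₀, x ∈ F ↔ y ∈ F) : x = y := by
  have := hX.t0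
  refine Inseparable.eq (inseparable_iff_forall_isClosed.2 fun F hF => ?_)
  obtain ⟨𝓢, h𝓢, rfl⟩ := hX.closedBase.2 F hF
  exact forall₂_congr fun G hG => h G (h𝓢 hG)

/-- In terms of `RC(X, X₀)`, the ultrafilters are the clans of the points of `X₀`: by compactness
of `X₀`, the traces of the members of an ultrafilter have a common point. -/
theorem IsTwoContact.isUltra_mem_iff (hX : IsTwoContact X₀) (x : X) :
    IsUltra {F : rcSub X₀ hX.dense | x ∈ F.1.carrier} ↔ x ∈ X₀ := by
  constructor
  · intro hu
    have := hX.stone.compact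
    let ι := {A : Clopens X₀ // x ∈ (closureIso hX.dense A).1.carrier}
    have : Nonempty ι := ⟨⊤, by rw [map_top]; exact mem_univ x⟩
    obtain ⟨y, hy⟩ := IsCompact.nonempty_iInter_of_directed_nonempty_isCompact_isClosed
      (fun A : ι => (A.1 : Set X₀))
      (fun A A' => ⟨⟨A.1 ⊓ A'.1, by
        rw [map_inf]
        exact hu.inf_mem (closureIso hX.dense A.1) (closureIso hX.dense A'.1) A.2 A'.2⟩, inter_subset_left, inter_subset_right⟩)
      (fun A => by
        by_contra hne
        have h0 : A.1 = ⊥ := Clopens.ext (not_nonempty_iff_eq_empty.1 hne)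
        have h1 := A.2
        rw [h0, map_bot] at h1
        exact h1)
      (fun A => A.1.isClosed.isCompact) (fun A => A.1.isClosed)
    have hsub : ∀ F : rcSub X₀ hX.dense, x ∈ F.1.carrier → (y : X) ∈ F.1.carrier := by
      intro F hF
      obtain ⟨A, rfl⟩ := (closureIso hX.dense).surjective F
      exact (mem_closure_clopens_iff A y).2 (mem_iInter.1 hy ⟨A, hF⟩)
    have hiff : ∀ F ∈ RCPair X₀, x ∈ F ↔ (y : X) ∈ F := by
      intro F hF
      let G : rcSub X₀ hX.dense := ⟨⟨F, rcPair_isRegClosed hX.dense hF⟩, hF⟩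
      refine ⟨hsub G, fun h => (hu.mem_or_compl G).resolve_right fun h' => ?_⟩
      exact (mem_compl_iff_notMem hX.dense G y).1 (hsub _ h') h
    exact hX.eq_of_forall_mem_iff hiff ▸ y.2
  · intro hx
    exact (isClan_mem hX.dense x).isUltra fun F hF hF' =>
      (mem_compl_iff_notMem hX.dense F ⟨x, hx⟩).1 hF' hF

end Topology

/-! ### The canonical constructions on isomorphism classes -/

theorem isClan_preimage {B B' : Type u} [BooleanAlgebra B] [BooleanAlgebra B'] {C : B → B → Prop}
    {C' : B' → B' → Prop} {φ : B → B'} (h : IsCAIso C C' φ) {Γ : Set B'} :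
    IsClan C (φ ⁻¹' Γ) ↔ IsClan C' Γ := by
  have hs : ∀ a b, Sharp C a b ↔ Sharp C' (φ a) (φ b) := fun a b => by
    rw [Sharp, Sharp, h.rel_iff, h.rel_iff, ← h.map_inf, ← h.map_bot, h.bijective.1.ne_iff]
  constructor
  · intro hΓ
    refine ⟨?_, ?_, ?_, ?_, ?_⟩
    · obtain ⟨a, ha⟩ := hΓ.nonempty
      exact ⟨_, ha⟩
    · rw [← h.map_bot]
      exact hΓ.bot_notMem
    · refine h.bijective.2.forall₂.2 fun a b ha hab => ?_
      exact hΓ.mem_of_le a b ha (h.le_iff_le.1 hab)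
    · refine h.bijective.2.forall₂.2 fun a b hab => ?_
      rw [← h.map_sup] at hab
      exact hΓ.sup_mem a b hab
    · exact h.bijective.2.forall₂.2 fun a b ha hb => (hs a b).1 (hΓ.sharp a b ha hb)
  · intro hΓ
    refine ⟨?_, ?_, fun a b ha hab => ?_, fun a b hab => ?_, fun a b ha hb => ?_⟩
    · obtain ⟨b, hb⟩ := hΓ.nonempty
      obtain ⟨a, rfl⟩ := h.bijective.2 b
      exact ⟨a, hb⟩
    · rw [mem_preimage, h.map_bot]
      exact hΓ.bot_notMem
    · exact hΓ.mem_of_le _ _ ha (h.le_iff_le.2 hab)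
    · rw [mem_preimage, h.map_sup] at hab
      exact hΓ.sup_mem _ _ hab
    · exact (hs a b).2 (hΓ.sharp _ _ ha hb)

theorem isUltra_preimage {B B' : Type u} [BooleanAlgebra B] [BooleanAlgebra B'] {C : B → B → Prop}
    {C' : B' → B' → Prop} {φ : B → B'} (h : IsCAIso C C' φ) {U : Set B'} :
    IsUltra (φ ⁻¹' U) ↔ IsUltra U := by
  constructor
  · intro hU
    refine ((isClan_preimage h).1 (hU.isClan C)).isUltra (h.bijective.2.forall.2 fun a ha => ?_)
    rw [← h.map_compl]
    exact hU.compl_notMem ha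
  · intro hU
    refine ((isClan_preimage h).2 (hU.isClan C')).isUltra fun a ha ha' => ?_
    rw [mem_preimage, h.map_compl] at ha'
    exact hU.compl_notMem ha ha'

/-- A 2-contact space whose canonical algebra is isomorphic to `A` is isomorphic to the canonical
space of `A`, by sending a point `x` to the clan `{a | x ∈ φ a}`. -/
theorem exists_homeomorph_space {A : ContactAlgebra.{u}} {S : TwoContactSpace.{u}}
    {φ : A.carrier → S.algebra.carrier} (h : IsCAIso A.rel S.algebra.rel φ) :
    ∃ f : S.carrier ≃ₜ A.space.carrier, f '' S.sub = A.space.sub := by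
  have hX := S.isTwoContact
  let f : S.carrier → Clans A.rel := fun x =>
    ⟨φ ⁻¹' {F | x ∈ F.1.carrier}, (isClan_preimage h).2 (isClan_mem hX.dense x)⟩
  have hf : Function.Bijective f := by
    constructor
    · intro x y hxy
      refine hX.eq_of_forall_mem_iff fun F hF => ?_
      obtain ⟨a, ha⟩ := h.bijective.2 ⟨⟨F, rcPair_isRegClosed hX.dense hF⟩, hF⟩
      have := Set.ext_iff.1 (congrArg Clans.carrier hxy) a
      change x ∈ (φ a).1.carrier ↔ y ∈ (φ a).1.carrier at this
      rwa [ha] at this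
    · intro Γ
      have hpre : φ ⁻¹' (φ '' Γ.carrier) = Γ.carrier := preimage_image_eq _ h.bijective.1
      have hc : IsClan S.algebra.rel (φ '' Γ.carrier) := by
        rw [← isClan_preimage h, hpre]
        exact Γ.2
      obtain ⟨x, hx⟩ := hX.exists_point hc
      refine ⟨x, Clans.ext ?_⟩
      rw [← hpre, hx]
      rfl
  let e := Equiv.ofBijective f hf
  have he : ∀ Γ a, e.symm Γ ∈ (φ a).1.carrier ↔ a ∈ Γ.carrier := fun Γ a => by
    conv_rhs => rw [← e.apply_symm_apply Γ]
    rfl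
  refine ⟨⟨e, ?_, ?_⟩, ?_⟩
  · refine continuous_generateFrom_iff.2 ?_
    rintro _ ⟨a, rfl⟩
    exact (φ a).1.2.isClosed.isOpen_compl
  · refine continuous_iff_isClosed.2 fun F hF => ?_
    obtain ⟨𝓢, h𝓢, rfl⟩ := hX.closedBase.2 F hF
    rw [preimage_sInter]
    refine isClosed_biInter fun G hG => ?_
    obtain ⟨a, ha⟩ := h.bijective.2 ⟨⟨G, rcPair_isRegClosed hX.dense (h𝓢 hG)⟩, h𝓢 hG⟩
    have hG' : e.symm ⁻¹' G = gMap A.rel a := Set.ext fun Γ => by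
      refine Iff.trans ?_ (he Γ a)
      rw [ha]
      rfl
    exact hG' ▸ isClosed_gMap A.rel a
  · have hU : ∀ x, f x ∈ ultSet A.rel ↔ x ∈ S.sub := fun x =>
      (isUltra_preimage h).trans (hX.isUltra_mem_iff x)
    ext Γ
    obtain ⟨x, rfl⟩ := hf.2 Γ
    exact ⟨fun ⟨y, hy, hyx⟩ => hf.1 hyx ▸ (hU y).2 hy, fun hx => ⟨x, (hU x).1 hx, rfl⟩⟩

theorem ContactAlgebra.equiv_space_algebra (A : ContactAlgebra.{u}) : A ≈ A.space.algebra :=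
  ⟨gIso A.rel, isCAIso_gIso A.isContact⟩

theorem TwoContactSpace.equiv_algebra_space (S : TwoContactSpace.{u}) : S ≈ S.algebra.space := by
  obtain ⟨φ, h⟩ := Setoid.refl S.algebra
  exact exists_homeomorph_space h

theorem ContactAlgebra.space_congr {A A' : ContactAlgebra.{u}} (h : A ≈ A') :
    A.space ≈ A'.space := by
  obtain ⟨φ, hφ⟩ := Setoid.trans h A'.equiv_space_algebra
  exact Setoid.symm (exists_homeomorph_space hφ)

theorem image_mem_rcPair {X Y : Type u} [TopologicalSpace X] [TopologicalSpace Y] {X₀ : Set X}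
    {Y₀ : Set Y} (f : X ≃ₜ Y) (h : f '' X₀ = Y₀) {F : Set X} (hF : F ∈ RCPair X₀) :
    f '' F ∈ RCPair Y₀ := by
  obtain ⟨A, rfl⟩ := hF
  have hmem : ∀ y : Y₀, f.symm y ∈ X₀ := by
    rintro ⟨y, hy⟩
    rw [← h] at hy
    obtain ⟨x, hx, rfl⟩ := hy
    simpa using hx
  let g : Y₀ → X₀ := fun y => ⟨f.symm y, hmem y⟩
  have hg : Continuous g := (f.symm.continuous.comp continuous_subtype_val).subtype_mk _
  refine ⟨⟨g ⁻¹' A, A.isClopen.preimage hg⟩, ?_⟩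
  rw [f.image_closure]
  congr 1
  ext y
  constructor
  · rintro ⟨y, hy, rfl⟩
    exact ⟨f.symm y, ⟨g y, hy, rfl⟩, f.apply_symm_apply y⟩
  · rintro ⟨_, ⟨x, hx, rfl⟩, rfl⟩
    have hx' : g ⟨f x, h ▸ mem_image_of_mem f x.2⟩ = x := Subtype.ext (f.symm_apply_apply x)
    exact ⟨⟨f x, h ▸ mem_image_of_mem f x.2⟩, by
      rw [← hx'] at hx
      exact hx, rfl⟩

theorem IsRegClosed.image {X Y : Type u} [TopologicalSpace X] [TopologicalSpace Y] (f : X ≃ₜ Y)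
    {F : Set X} (hF : IsRegClosed F) : IsRegClosed (f '' F) := by
  rw [IsRegClosed, ← f.image_interior, ← f.image_closure, hF]

theorem TwoContactSpace.algebra_congr {S S' : TwoContactSpace.{u}} (h : S ≈ S') :
    S.algebra ≈ S'.algebra := by
  obtain ⟨f, h⟩ := h
  let φ : rcSub S.sub S.isTwoContact.dense ↪o rcSub S'.sub S'.isTwoContact.dense :=
    OrderEmbedding.ofMapLEIff (fun F => ⟨⟨f '' F.1.1, F.1.2.image f⟩, image_mem_rcPair f h F.2⟩)
      fun F G => image_subset_image_iff f.injective
  have hφ : Function.Surjective φ := by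
    rintro ⟨⟨F, hF⟩, hF'⟩
    have h' : f.symm '' S'.sub = S.sub := by
      rw [← h, ← image_comp, f.symm_comp_self, image_id]
    exact ⟨⟨⟨f.symm '' F, hF.image f.symm⟩, image_mem_rcPair f.symm h' hF'⟩,
      Subtype.ext (RC.ext (f.image_symm_image F))⟩
  refine ⟨RelIso.ofSurjective φ hφ, isCAIso_of_orderIso (RelIso.ofSurjective φ hφ) fun F G => ?_⟩
  change (F.1.1 ∩ G.1.1).Nonempty ↔ (f '' F.1.1 ∩ f '' G.1.1).Nonempty
  rw [← image_inter f.injective, image_nonempty]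

/-- The bijection between isomorphism classes induced by the two canonical constructions. -/
def classEquiv : CAClass.{u} ≃ CSClass.{u} where
  toFun := Quotient.map ContactAlgebra.space fun _ _ => ContactAlgebra.space_congr
  invFun := Quotient.map TwoContactSpace.algebra fun _ _ => TwoContactSpace.algebra_congr
  left_inv := by
    rintro ⟨A⟩
    exact Quotient.sound (Setoid.symm A.equiv_space_algebra)
  right_inv := by
    rintro ⟨S⟩
    exact Quotient.sound (Setoid.symm S.equiv_algebra_space)

theorem ContactAlgebra.connected_iff (A : ContactAlgebra.{u}) :
    A.Connected ↔ A.space.Connected :=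
  isConnectedRel_iff_preconnectedSpace A.isContact

theorem TwoContactSpace.Connected.algebra {S : TwoContactSpace.{u}} (h : S.Connected) :
    S.algebra.Connected := by
  rw [ContactAlgebra.connected_iff]
  obtain ⟨f, -⟩ := S.equiv_algebra_space
  have : PreconnectedSpace S.carrier := h
  refine ⟨?_⟩
  rw [← image_univ_of_surjective f.surjective]
  exact isPreconnected_univ.image f f.continuous.continuousOn

end TwoContact

theorem theorem7p1 :
    (∀ A : TwoContact.ContactAlgebra.{u},
      (∃ φ : A.carrier → A.space.algebra.carrier,
        TwoContact.IsCAIso A.rel A.space.algebra.rel φ ∧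
        ∀ a : A.carrier, (φ a).1.carrier = TwoContact.gMap A.rel a) ∧
      (TwoContact.RCPair A.space.sub = {F : Set A.space.carrier | TwoContact.IsRegClosed F} ↔
        A.Complete) ∧
      (A.Connected ↔ A.space.Connected)) ∧
    ∃ e : TwoContact.CAClass.{u} ≃ TwoContact.CSClass.{u},
      (∀ A : TwoContact.ContactAlgebra.{u}, e A.cls = A.space.cls) ∧
      (∀ S : TwoContact.TwoContactSpace.{u}, e.symm S.cls = S.algebra.cls) ∧
      Set.BijOn e
        {c | ∃ A : TwoContact.ContactAlgebra.{u}, A.Connected ∧ A.cls = c}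
        {c | ∃ S : TwoContact.TwoContactSpace.{u}, S.Connected ∧ S.cls = c} := by
  refine ⟨fun A => ⟨⟨TwoContact.gIso A.rel, TwoContact.isCAIso_gIso A.isContact, fun _ => rfl⟩,
    TwoContact.rcPair_eq_regClosed_iff A.rel, A.connected_iff⟩,
    TwoContact.classEquiv, fun _ => rfl, fun _ => rfl, ?_,
    TwoContact.classEquiv.injective.injOn, ?_⟩
  · rintro _ ⟨A, hA, rfl⟩
    exact ⟨A.space, A.connected_iff.1 hA, rfl⟩
  · rintro _ ⟨S, hS, rfl⟩
    exact ⟨S.algebra.cls, ⟨S.algebra, hS.algebra, rfl⟩, TwoContact.classEquiv.right_inv S.cls⟩
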